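/- **Proposition 2.6.** Let $n\ge 1$ and let $A$ be an $n\times n$ matrix with entries in $\{0,1\}$ such that, for some integer $m\ge 1$, all entries of $A^m$ are strictly positive. Let $$\Sigma_A=\{x=(x_0,x_1,\dots)\in\{1,\dots,n\}^{\mathbf N}: A_{x_i,x_{i+1}}=1\text{ for all } i\ge 0\}$$ with the product topology, and let $\sigma(x_0,x_1,x_2,\dots)=(x_1,x_2,\dots)$ be the left shift. Fix $\theta\in(0,1)$ and equip $\Sigma_A$ with the metric $d(x,y)=\theta^{N(x,y)}$, where $N(x,y)$ is the largest integer $N$ such that $x_i=y_i$ for all $i<N$, and $d(x,x)=0$. For a real continuous function $\phi$ on $\Sigma_A$ let $\mathcal L_\phi$ be the transfer operator on the space $C(\Sigma_A)$ of continuous complex functions (with the supremum norm), given by $$\mathcal L_\phi(f)(x)=\sum_{y\in\sigma^{-1}(\{x\})}e^{\phi(y)}f(y).$$ Call a real number $\lambda>0$ a *Ruelle eigenvalue* for $\phi$ if there are a strictly positive function $h\in C(\Sigma_A)$ and a Borel probability measure $\nu$ on $\Sigma_A$ such that $\mathcal L_\phi(h)=\lambda h$, $\int \mathcal L_\phi(f)\,d\nu=\lambda\int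 f\,d\nu$ for every $f\in C(\Sigma_A)$, and $\lim_{k\to\infty}\|\lambda^{-k}\mathcal L_\phi^k(g)-(\int g\,d\nu)\,h\|=0$ for every $g\in C(\Sigma_A)$. Let $H:\Sigma_A\to\mathbf R$ be Hölder continuous with respect to $d$ (that is, $|H(x)-H(y)|\le K\,d(x,y)^\alpha$ for all $x,y$, for some constants $K,\alpha>0$) with $H(y)>1$ for all $y\in\Sigma_A$, and put $\phi_\beta=-\beta\log H$. Then for every $\beta\ge 0$ there is exactly one Ruelle eigenvalue $\lambda(\beta)$ for $\phi_\beta$, and (i) if $n\ge 2$, then $\lambda(0)>1$; (ii) $\lim_{\beta\to\infty}\lambda(\beta)=0$; (iii) $\lambda$ is a continuous, strictly decreasing function of $\beta\in[0,\infty)$. -/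

import Mathlib

open scoped Topology

/-- The one-sided Markov space of `A`: all sequences `x` of indices with
`A (x i) (x (i + 1)) = 1` for every `i`. As a subtype of `ℕ → Fin n` it carries the product
topology and its Borel σ-algebra. -/
abbrev MarkovSpace {n : ℕ} (A : Matrix (Fin n) (Fin n) ℕ) : Type :=
  {x : ℕ → Fin n // ∀ i, A (x i) (x (i + 1)) = 1}

namespace MarkovSpace

variable {n : ℕ} {A : Matrix (Fin n) (Fin n) ℕ}

instance : CompactSpace (MarkovSpace A) := by
  apply isCompact_iff_compactSpace.mp
  apply IsClosed.isCompact
  have h : {x : ℕ → Fin n | ∀ i, A (x i) (x (i + 1)) = 1} =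
      ⋂ i, (fun x : ℕ → Fin n => (x i, x (i + 1))) ⁻¹'
        {p : Fin n × Fin n | A p.1 p.2 = 1} := by
    ext x
    simp
  change IsClosed {x : ℕ → Fin n | ∀ i, A (x i) (x (i + 1)) = 1}
  rw [h]
  exact isClosed_iInter fun i => (isClosed_discrete _).preimage (by fun_prop)

/-- The left shift. -/
def shift (x : MarkovSpace A) : MarkovSpace A :=
  ⟨fun i => x.1 (i + 1), fun i => x.2 (i + 1)⟩

/-- The sequence `j, x 0, x 1, …`, when the transition from `j` to `x 0` is allowed. -/
def prepend (j : Fin n) (x : MarkovSpace A) (h : A j (x.1 0) = 1) : MarkovSpace A :=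
  ⟨fun i => Nat.casesOn i j x.1, fun i => by
    cases i with
    | zero => exact h
    | succ i => exact x.2 i⟩

theorem shift_eq_iff (x y : MarkovSpace A) :
    shift y = x ↔ ∃ h : A (y.1 0) (x.1 0) = 1, y = prepend (y.1 0) x h := by
  constructor
  · rintro rfl
    refine ⟨y.2 0, Subtype.ext (funext fun i => ?_)⟩
    cases i <;> rfl
  · rintro ⟨h, e⟩
    rw [e]
    rfl

theorem finite_preimage (x : MarkovSpace A) : (shift ⁻¹' {x}).Finite := by
  apply Set.Finite.of_injOn (f := fun y : MarkovSpace A => y.1 0) (t := Set.univ)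
    (fun _ _ => Set.mem_univ _) _ Set.finite_univ
  intro y hy z hz hyz
  obtain ⟨_, hy'⟩ := (shift_eq_iff x y).1 hy
  obtain ⟨_, hz'⟩ := (shift_eq_iff x z).1 hz
  rw [hy', hz']
  simp only at hyz
  congr 1

/-- `𝓛 f (x)` is the sum of `f y` over all `y` with `shift y = x` (a finite set). -/
noncomputable def transferFun (f : MarkovSpace A → ℂ) (x : MarkovSpace A) : ℂ :=
  ∑ y ∈ (finite_preimage x).toFinset, f y

theorem transferFun_eq (f : MarkovSpace A → ℂ) (x : MarkovSpace A) :
    transferFun f x =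
      ∑ j : Fin n, if h : A j (x.1 0) = 1 then f (prepend j x h) else 0 := by
  classical
  have h1 : (∑ j : Fin n, if h : A j (x.1 0) = 1 then f (prepend j x h) else 0) =
      ∑ j ∈ Finset.univ.filter (fun j => A j (x.1 0) = 1),
        if h : A j (x.1 0) = 1 then f (prepend j x h) else 0 := by
    symm
    apply Finset.sum_subset (Finset.filter_subset _ _)
    intro j _ hj
    have : ¬ A j (x.1 0) = 1 := by simpa using hj
    rw [dif_neg this]
  rw [h1, transferFun]
  refine Finset.sum_bij (fun y _ => y.1 0) ?_ ?_ ?_ ?_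
  · intro y hy
    obtain ⟨h, _⟩ := (shift_eq_iff x y).1 (by simpa using hy)
    simpa using h
  · intro y hy z hz hyz
    obtain ⟨_, hy'⟩ := (shift_eq_iff x y).1 (by simpa using hy)
    obtain ⟨_, hz'⟩ := (shift_eq_iff x z).1 (by simpa using hz)
    rw [hy', hz']
    congr 1
  · intro j hj
    have hj' : A j (x.1 0) = 1 := by simpa using hj
    refine ⟨prepend j x hj', ?_, rfl⟩
    simp only [Set.Finite.mem_toFinset, Set.mem_preimage, Set.mem_singleton_iff]
    rfl
  · intro y hy
    obtain ⟨h, e⟩ := (shift_eq_iff x y).1 (by simpa using hy)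
    rw [dif_pos h, ← e]

theorem continuous_transferFun {f : MarkovSpace A → ℂ} (hf : Continuous f) :
    Continuous (transferFun f) := by
  rw [funext (transferFun_eq f)]
  refine continuous_finsetSum _ fun j _ => ?_
  have h0 : Continuous fun x : MarkovSpace A => x.1 0 :=
    (continuous_apply 0).comp continuous_subtype_val
  have hopen : ∀ s : Set (Fin n), IsOpen {x : MarkovSpace A | x.1 0 ∈ s} :=
    fun s => (isOpen_discrete s).preimage h0
  rw [continuous_iff_continuousAt]
  intro x
  by_cases hx : A j (x.1 0) = 1
  · have hU := hopen {i | A j i = 1}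
    refine ContinuousOn.continuousAt ?_ (hU.mem_nhds hx)
    rw [continuousOn_iff_continuous_domRestrict]
    have : Continuous fun z : {x : MarkovSpace A | x.1 0 ∈ {i | A j i = 1}} =>
        f (prepend j z.1 z.2) := by
      refine hf.comp (Continuous.subtype_mk (continuous_pi fun i => ?_) _)
      cases i with
      | zero => exact continuous_const
      | succ i =>
        change Continuous fun z : {x : MarkovSpace A | x.1 0 ∈ {i | A j i = 1}} => z.1.1 i
        exact (continuous_apply i).comp (continuous_subtype_val.comp continuous_subtype_val)
    refine this.congr fun z => ?_
    have hz : A j (z.1.1 0) = 1 := z.2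
    simp only [Set.domRestrict_apply]
    rw [dif_pos hz]
  · have hU := hopen {i | ¬ A j i = 1}
    refine (continuousAt_const (y := (0 : ℂ))).congr ?_
    filter_upwards [hU.mem_nhds hx] with z hz
    have hz' : ¬ A j (z.1 0) = 1 := hz
    rw [dif_neg hz']

variable (A) in
/-- The operator `𝓛` on the space `C(Σ_A)` of complex continuous functions. -/
noncomputable def transfer : C(MarkovSpace A, ℂ) →ₗ[ℂ] C(MarkovSpace A, ℂ) where
  toFun f := ⟨transferFun f, continuous_transferFun f.continuous⟩
  map_add' f g := by
    ext x
    simp [transferFun, Finset.sum_add_distrib]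
  map_smul' c f := by
    ext x
    simp [transferFun, Finset.mul_sum]

/-- The function `e ^ φ`, as a complex continuous function. -/
noncomputable def expFun (φ : C(MarkovSpace A, ℝ)) : C(MarkovSpace A, ℂ) :=
  ⟨fun x => ((Real.exp (φ x) : ℝ) : ℂ), by fun_prop⟩

/-- Ruelle's transfer operator `𝓛_φ f = 𝓛 (e ^ φ f)`. -/
noncomputable def ruelle (φ : C(MarkovSpace A, ℝ)) :
    C(MarkovSpace A, ℂ) →ₗ[ℂ] C(MarkovSpace A, ℂ) :=
  transfer A ∘ₗ LinearMap.mulLeft ℂ (expFun φ)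

/-- The metric `d(x, y) = θ ^ N(x, y)`, where `N(x, y)` is the largest `N` with `x i = y i` for
all `i < N`, that is, the first index at which `x` and `y` differ; `d(x, x) = 0`. -/
noncomputable def markovDist (θ : ℝ) (x y : MarkovSpace A) : ℝ :=
  open Classical in if x = y then 0 else θ ^ PiNat.firstDiff (E := fun _ => Fin n) x.1 y.1

/-- Hölder continuity with respect to the metric with parameter `θ`. -/
def IsHolder (θ : ℝ) (φ : MarkovSpace A → ℝ) : Prop :=
  ∃ K α : ℝ, 0 < K ∧ 0 < α ∧ ∀ x y, |φ x - φ y| ≤ K * markovDist θ x y ^ α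

/-- `l` is an eigenvalue as in the Ruelle–Perron–Frobenius theorem for `φ`: `l > 0`, and there are
a strictly positive `h ∈ C(Σ_A)` and a Borel probability measure `ν` with `𝓛_φ h = l h`,
`𝓛_φ* ν = l ν` (as functionals on `C(Σ_A)`), and `‖l⁻ᵏ 𝓛_φᵏ g - ν(g) h‖ → 0` in the
supremum norm for every `g ∈ C(Σ_A)`. -/
def IsRuelleEigenvalue (φ : C(MarkovSpace A, ℝ)) (l : ℝ) : Prop :=
  0 < l ∧
  ∃ (h : C(MarkovSpace A, ℂ)) (ν : MeasureTheory.Measure (MarkovSpace A)),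
    (∀ x, 0 < (h x).re ∧ (h x).im = 0) ∧
    MeasureTheory.IsProbabilityMeasure ν ∧
    ruelle φ h = (l : ℂ) • h ∧
    (∀ f : C(MarkovSpace A, ℂ), ∫ x, ruelle φ f x ∂ν = (l : ℂ) * ∫ x, f x ∂ν) ∧
    ∀ g : C(MarkovSpace A, ℂ),
      Filter.Tendsto
        (fun k : ℕ => ‖((l : ℂ) ^ k)⁻¹ • (ruelle φ ^ k) g - (∫ x, g x ∂ν) • h‖)
        Filter.atTop (𝓝 0)

/-- The potential `φ_β = -β log H` for a strictly positive continuous function `H`. -/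
noncomputable def potential (H : C(MarkovSpace A, ℝ)) (hH : ∀ x, 0 < H x) (β : ℝ) :
    C(MarkovSpace A, ℝ) :=
  ⟨fun x => -β * Real.log (H x),
    continuous_const.mul (H.continuous.log fun x => (hH x).ne')⟩

end MarkovSpace

/-!
The existence of `λ(β)` is the Ruelle–Perron–Frobenius theorem for Hölder potentials, proved here
through compactness and positivity. Nonnegative functions `f` with
`f x ≤ exp (B * ρ ^ N) * f y` whenever `x` and `y` share their first `N ≥ 1` symbols form a cone
that the transfer operator preserves, and whose bounded parts are compact by Arzelà–Ascoli. On the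
unit slice of this cone the largest `t` with `t • f ≤ L f` is attained, and since powers of `L` make
nonzero nonnegative functions strictly positive, a maximizer is an eigenvector `h`
(`IsPrimitiveOperator.exists_eigenvector`).

Put `T = l⁻¹ • L`, so that `T h = h`. For `f ≥ 0` with precompact orbit, the smallest `m` with
`T ^ k f ≤ m • h` decreases to a limit; a limit point of the orbit keeps this value under all powers
of `T`, so by strict positivity it is the multiple `m • h` itself, and the whole orbit converges
(`IsPrimitiveOperator.exists_tendsto`). A positive continuous function has precompact orbit, because
the modulus of continuity of its logarithm can be added to `B * ρ ^ N` in the definition of the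
cone; every continuous function differs from a positive one by a constant. The limiting multiples
are a positive functional, which Riesz–Markov–Kakutani represents by `ν`.

Everything else follows from a comparison (`IsRuelleEigenvalue.exp_mul_le`): if `φ + c ≤ ψ` then
`exp c * l ≤ l'` for the corresponding eigenvalues, which is seen by integrating
`L_ψ h ≥ exp c • L_φ h` against the eigenmeasure of `ψ`. With `c = 0` this is uniqueness; since
`log H` lies between two positive constants, it also bounds `λ(γ) / λ(β)` between two exponentials
of `β - γ`, whence the limit, the monotonicity and the continuity. Finally
`L_0 ^ m 1 ≥ n` forces `λ(0) ^ m ≥ n`.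
-/

open Filter Topology MeasureTheory

/-! ### Positive operators on `C(X, ℝ)` -/

instance {X : Type*} [TopologicalSpace X] [CompactSpace X] : OrderClosedTopology C(X, ℝ) where
  isClosed_le' := by
    have h : {p : C(X, ℝ) × C(X, ℝ) | p.1 ≤ p.2} = ⋂ x, {p | p.1 x ≤ p.2 x} := by
      ext p
      simp [ContinuousMap.le_def]
    rw [h]
    exact isClosed_iInter fun x => isClosed_le
      ((continuous_eval_const x).comp continuous_fst)
      ((continuous_eval_const x).comp continuous_snd)

/-- A bounded operator on `C(X, ℝ)` that preserves nonnegative functions and some positive power of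
which, depending on the function, makes a given nonzero nonnegative function strictly positive. -/
structure IsPrimitiveOperator {X : Type*} [TopologicalSpace X] [CompactSpace X]
    (L : C(X, ℝ) →L[ℝ] C(X, ℝ)) : Prop where
  nonneg : ∀ f, 0 ≤ f → 0 ≤ L f
  pos : ∀ f, 0 ≤ f → f ≠ 0 → ∃ N : ℕ, 0 < N ∧ ∀ x, 0 < (L ^ N) f x

theorem smul_pow_apply {E : Type*} [NormedAddCommGroup E] [NormedSpace ℝ E] (L : E →L[ℝ] E)
    (c : ℝ) (k : ℕ) (f : E) : ((c • L) ^ k) f = c ^ k • (L ^ k) f := by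
  induction k with
  | zero => simp
  | succ k ih =>
    rw [pow_succ', pow_succ' L]
    change c • L (((c • L) ^ k) f) = _ • L ((L ^ k) f)
    rw [ih, map_smul, smul_smul, pow_succ']

namespace IsPrimitiveOperator

variable {X : Type*} [TopologicalSpace X] [CompactSpace X] {L : C(X, ℝ) →L[ℝ] C(X, ℝ)}

theorem mono (hL : IsPrimitiveOperator L) {f g : C(X, ℝ)} (hfg : f ≤ g) : L f ≤ L g := by
  have h := hL.nonneg (g - f) (sub_nonneg.2 hfg)
  rwa [map_sub, sub_nonneg] at h

theorem pow_nonneg (hL : IsPrimitiveOperator L) {f : C(X, ℝ)} (hf : 0 ≤ f) (k : ℕ) :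
    0 ≤ (L ^ k) f := by
  induction k with
  | zero => simpa using hf
  | succ k ih => rw [pow_succ']; exact hL.nonneg _ ih

theorem pow_mono (hL : IsPrimitiveOperator L) {f g : C(X, ℝ)} (hfg : f ≤ g) (k : ℕ) :
    (L ^ k) f ≤ (L ^ k) g := by
  have h := hL.pow_nonneg (sub_nonneg.2 hfg) k
  rwa [map_sub, sub_nonneg] at h

theorem smul (hL : IsPrimitiveOperator L) {c : ℝ} (hc : 0 < c) : IsPrimitiveOperator (c • L) where
  nonneg f hf := smul_nonneg hc.le (hL.nonneg f hf)
  pos f hf hf0 := by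
    obtain ⟨N, hN0, hN⟩ := hL.pos f hf hf0
    refine ⟨N, hN0, fun x => ?_⟩
    rw [smul_pow_apply]
    exact mul_pos (pow_pos hc N) (hN x)

end IsPrimitiveOperator

theorem pow_apply_eigen {E : Type*} [NormedAddCommGroup E] [NormedSpace ℝ E] {L : E →L[ℝ] E}
    {h : E} {l : ℝ} (e : L h = l • h) (k : ℕ) : (L ^ k) h = l ^ k • h := by
  induction k with
  | zero => simp
  | succ k ih =>
    rw [pow_succ]
    change (L ^ k) (L h) = _
    rw [e, map_smul, ih, smul_smul, pow_succ']

theorem exists_pos_le_of_forall_pos {X : Type*} [TopologicalSpace X] [CompactSpace X] [Nonempty X]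
    (f : C(X, ℝ)) (hf : ∀ x, 0 < f x) : ∃ c : ℝ, 0 < c ∧ ∀ x, c ≤ f x := by
  obtain ⟨x, -, hx⟩ := isCompact_univ.exists_isMinOn Set.univ_nonempty f.continuous.continuousOn
  exact ⟨f x, hf x, fun y => hx (Set.mem_univ y)⟩

/-- The maximum of `t` over pairs `(t, f)` with `f` in the slice and `t • f ≤ L f` is attained, and
at a maximizing `f` equality must hold: otherwise a power of `L` turns `L f - t • f` into a strictly
positive function, which leaves room to increase `t`. -/
theorem IsPrimitiveOperator.exists_eigenvector {X : Type*} [TopologicalSpace X] [CompactSpace X]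
    [Nonempty X] {L : C(X, ℝ) →L[ℝ] C(X, ℝ)} (hL : IsPrimitiveOperator L) (S : Set C(X, ℝ))
    (hS0 : ∀ f ∈ S, 0 ≤ f) (hSL : ∀ f ∈ S, L f ∈ S)
    (hSsmul : ∀ f ∈ S, ∀ c : ℝ, 0 < c → c • f ∈ S)
    (hScompact : IsCompact (S ∩ {f | ‖f‖ = 1})) (hSne : ∃ f ∈ S, f ≠ 0) :
    ∃ (l : ℝ) (h : C(X, ℝ)), 0 < l ∧ h ∈ S ∧ (∀ x, 0 < h x) ∧ L h = l • h := by
  have hnormalize : ∀ f ∈ S, f ≠ 0 → ‖f‖⁻¹ • f ∈ S ∩ {f | ‖f‖ = 1} := fun f hf hf0 =>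
    ⟨hSsmul f hf _ (inv_pos.2 (norm_pos_iff.2 hf0)), by
      simp [norm_smul, norm_ne_zero_iff.2 hf0]⟩
  set P : Set (ℝ × C(X, ℝ)) :=
    (Set.Icc 0 ‖L‖ ×ˢ (S ∩ {f | ‖f‖ = 1})) ∩ {p | p.1 • p.2 ≤ L p.2}
  have hPc : IsCompact P := by
    refine (isCompact_Icc.prod hScompact).inter_right (isClosed_le ?_ ?_) <;> fun_prop
  have hPne : P.Nonempty := by
    obtain ⟨f, hf, hf0⟩ := hSne
    refine ⟨(0, ‖f‖⁻¹ • f), ⟨⟨⟨le_rfl, norm_nonneg L⟩, hnormalize f hf hf0⟩, ?_⟩⟩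
    simpa using hL.nonneg _ (hS0 _ (hnormalize f hf hf0).1)
  obtain ⟨⟨t, f⟩, ⟨⟨ht, hfS, hf1⟩, htf⟩, hmax⟩ :=
    hPc.exists_isMaxOn hPne continuous_fst.continuousOn
  simp only [Set.mem_ofPred_eq] at hf1 htf
  have hf0 : f ≠ 0 := by rintro rfl; simp at hf1
  have hpowS : ∀ k, (L ^ k) f ∈ S := fun k => by
    induction k with
    | zero => simpa using hfS
    | succ k ih => rw [pow_succ']; exact hSL _ ih
  have heq : L f = t • f := by
    by_contra hne
    obtain ⟨N, -, hN⟩ := hL.pos _ (sub_nonneg.2 htf) (sub_ne_zero.2 hne)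
    set F := (L ^ N) f
    have hcomm : (L ^ N) (L f - t • f) = L F - t • F := by
      rw [map_sub, map_smul]
      congr 1
      change (L ^ N * L) f = (L * L ^ N) f
      rw [← pow_succ, ← pow_succ']
    rw [hcomm] at hN
    obtain ⟨d, hd, hdF⟩ := exists_pos_le_of_forall_pos _ hN
    have hF0 : F ≠ 0 := by
      intro h0
      obtain ⟨x⟩ := ‹Nonempty X›
      have := hN x
      simp [h0] at this
    have hFn : 0 < ‖F‖ := norm_pos_iff.2 hF0
    have hle : (t + d / ‖F‖) • F ≤ L F := fun x => by
      have h1 := hdF x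
      simp only [ContinuousMap.sub_apply, ContinuousMap.smul_apply, smul_eq_mul] at h1 ⊢
      change (t + d / ‖F‖) * F x ≤ (L F) x
      have h2 : d / ‖F‖ * F x ≤ d := by
        rw [div_mul_eq_mul_div, div_le_iff₀ hFn]
        exact mul_le_mul_of_nonneg_left ((le_abs_self _).trans (F.norm_coe_le_norm x)) hd.le
      linarith
    set G := ‖F‖⁻¹ • F
    have hG := hnormalize F (hpowS N) hF0
    have hleG : (t + d / ‖F‖) • G ≤ L G := by
      rw [map_smul, smul_comm]
      exact smul_le_smul_of_nonneg_left hle (inv_pos.2 hFn).le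
    have ht' : 0 < t + d / ‖F‖ := by have := ht.1; positivity
    have hub : t + d / ‖F‖ ≤ ‖L‖ := by
      have h1 : ‖(t + d / ‖F‖) • G‖ ≤ ‖L G‖ := by
        refine (ContinuousMap.norm_le _ (norm_nonneg _)).2 fun x => ?_
        have h0 : 0 ≤ ((t + d / ‖F‖) • G) x := smul_nonneg ht'.le (hS0 G hG.1) x
        rw [Real.norm_of_nonneg h0]
        exact (hleG x).trans ((le_abs_self _).trans ((L G).norm_coe_le_norm x))
      have h2 := L.le_opNorm G
      rw [norm_smul, hG.2, mul_one, Real.norm_of_nonneg ht'.le] at h1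
      rw [hG.2, mul_one] at h2
      exact h1.trans h2
    have := hmax (show (t + d / ‖F‖, G) ∈ P from ⟨⟨⟨ht'.le, hub⟩, hG⟩, hleG⟩)
    simp only [Set.mem_ofPred_eq] at this
    have : 0 < d / ‖F‖ := by positivity
    linarith
  obtain ⟨N, hN0, hN⟩ := hL.pos f (hS0 f hfS) hf0
  rw [pow_apply_eigen heq] at hN
  have htN : 0 < t ^ N := by
    refine lt_of_le_of_ne (_root_.pow_nonneg ht.1 N) fun h0 => ?_
    obtain ⟨x⟩ := ‹Nonempty X›
    have := hN x
    simp [← h0] at this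
  have hfpos : ∀ x, 0 < f x := fun x => (pos_iff_pos_of_mul_pos (hN x)).1 htN
  refine ⟨t, f, lt_of_le_of_ne ht.1 ?_, hfS, hfpos, heq⟩
  rintro (rfl : 0 = t)
  simp [zero_pow hN0.ne'] at htN

/-- The distance from the multiples of `h` is measured by the weighted norm `‖F / h‖`, which `T`
does not increase. -/
theorem IsPrimitiveOperator.exists_tendsto {X : Type*} [TopologicalSpace X] [CompactSpace X]
    [Nonempty X] {T : C(X, ℝ) →L[ℝ] C(X, ℝ)} (hT : IsPrimitiveOperator T) {h : C(X, ℝ)}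
    (hpos : ∀ x, 0 < h x) (hTh : T h = h) {f : C(X, ℝ)} (hf : 0 ≤ f) {K : Set C(X, ℝ)}
    (hK : IsCompact K) (hfK : ∀ k : ℕ, (T ^ k) f ∈ K) :
    ∃ c : ℝ, Tendsto (fun k : ℕ => (T ^ k) f) atTop (𝓝 (c • h)) := by
  have hTkh : ∀ k : ℕ, (T ^ k) h = h := fun k => by
    simpa using pow_apply_eigen (l := 1) (by simpa using hTh) k
  let w : C(X, ℝ) := ⟨fun x => (h x)⁻¹, h.continuous.inv₀ fun x => (hpos x).ne'⟩
  let s : C(X, ℝ) → ℝ := fun F => ‖w * F‖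
  have hsc : Continuous s := by fun_prop
  have hs_le : ∀ (F : C(X, ℝ)) {c : ℝ}, 0 ≤ c → (s F ≤ c ↔ ∀ x, |F x| ≤ c * h x) := by
    intro F c hc
    refine (ContinuousMap.norm_le _ hc).trans (forall_congr' fun x => ?_)
    change |(h x)⁻¹ * F x| ≤ c ↔ _
    rw [abs_mul, abs_of_pos (inv_pos.2 (hpos x)), inv_mul_le_iff₀ (hpos x), mul_comm]
  have hs_self : ∀ (F : C(X, ℝ)) x, |F x| ≤ s F * h x := fun F =>
    (hs_le F (norm_nonneg _)).1 le_rfl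
  have hs_T : ∀ F, s (T F) ≤ s F := by
    intro F
    refine (hs_le _ (norm_nonneg _)).2 fun x => abs_le.2 ⟨?_, ?_⟩
    · have := hT.mono (f := -(s F • h)) (g := F) fun x => neg_le_of_abs_le (hs_self F x)
      rw [map_neg, map_smul, hTh] at this
      exact this x
    · have := hT.mono (f := F) (g := s F • h) fun x => le_of_abs_le (hs_self F x)
      rw [map_smul, hTh] at this
      exact this x
  have hanti : ∀ F, Antitone fun k : ℕ => s ((T ^ k) F) := fun F =>
    antitone_nat_of_succ_le fun k => by
      rw [pow_succ']
      exact hs_T _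
  have hlim : ∀ F, ∃ m, Tendsto (fun k : ℕ => s ((T ^ k) F)) atTop (𝓝 m) := fun F =>
    ⟨_, tendsto_atTop_ciInf (hanti F) ⟨0, by rintro _ ⟨k, rfl⟩; exact norm_nonneg _⟩⟩
  obtain ⟨m, hm⟩ := hlim f
  obtain ⟨g, -, u, hu, hug⟩ := hK.tendsto_subseq hfK
  have hg0 : 0 ≤ g := ge_of_tendsto' hug fun k => hT.pow_nonneg hf _
  have hsg : ∀ j : ℕ, s ((T ^ j) g) = m := fun j => by
    have h1 : Tendsto (fun k => s ((T ^ j) ((T ^ u k) f))) atTop (𝓝 (s ((T ^ j) g))) :=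
      ((hsc.comp (T ^ j).continuous).tendsto g).comp hug
    have h2 : Tendsto (fun k => s ((T ^ (j + u k)) f)) atTop (𝓝 m) :=
      hm.comp (tendsto_atTop_mono (fun k => (hu.id_le k).trans (Nat.le_add_left _ _)) tendsto_id)
    refine tendsto_nhds_unique h1 (h2.congr fun k => ?_)
    rw [pow_add]
    rfl
  -- Every power of `T` preserves the weighted norm of the limit point `g`, although some power makes
  -- a nonzero `m • h - g` strictly positive, which would lower that norm.
  have hgh : g = m • h := by
    by_contra hne
    have hle : g ≤ m • h := fun x => by
      have := hs_self g x
      rw [show s g = m by simpa using hsg 0] at this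
      exact le_of_abs_le this
    obtain ⟨N, -, hN⟩ := hT.pos _ (sub_nonneg.2 hle) (sub_ne_zero.2 (Ne.symm hne))
    rw [map_sub, map_smul, hTkh] at hN
    obtain ⟨d, hd, hdN⟩ := exists_pos_le_of_forall_pos _ hN
    have hgN := hT.pow_nonneg hg0 N
    have hhn : 0 < ‖h‖ := norm_pos_iff.2 fun h0 => by
      obtain ⟨x⟩ := ‹Nonempty X›
      have := hpos x
      simp [h0] at this
    have hub : ∀ x, |((T ^ N) g) x| ≤ (m - d / ‖h‖) * h x := fun x => by
      have h1 := hdN x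
      simp only [ContinuousMap.sub_apply, ContinuousMap.smul_apply, smul_eq_mul] at h1
      have h2 : d / ‖h‖ * h x ≤ d := by
        rw [div_mul_eq_mul_div, div_le_iff₀ hhn]
        exact mul_le_mul_of_nonneg_left ((le_abs_self _).trans (h.norm_coe_le_norm x)) hd.le
      rw [abs_of_nonneg (show 0 ≤ ((T ^ N) g) x from hgN x)]
      linarith
    have hc0 : 0 ≤ m - d / ‖h‖ := by
      obtain ⟨x⟩ := ‹Nonempty X›
      exact nonneg_of_mul_nonneg_left ((abs_nonneg _).trans (hub x)) (hpos x)
    have := (hs_le _ hc0).2 hub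
    rw [hsg N] at this
    have : 0 < d / ‖h‖ := by positivity
    linarith
  refine ⟨m, ?_⟩
  have hdiff : ∀ k : ℕ, (T ^ k) (f - m • h) = (T ^ k) f - m • h := fun k => by
    rw [map_sub, map_smul, hTkh]
  obtain ⟨e, he⟩ := hlim (f - m • h)
  simp only [hdiff] at he
  have he0 : e = 0 := by
    have h1 : Tendsto (fun k => s ((T ^ u k) f - m • h)) atTop (𝓝 (s (g - m • h))) :=
      ((hsc.comp (continuous_id.sub continuous_const)).tendsto g).comp hug
    have := tendsto_nhds_unique (he.comp hu.tendsto_atTop) h1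
    rw [this, hgh]
    simp [s]
  rw [he0] at he
  rw [tendsto_iff_norm_sub_tendsto_zero]
  have hbd : ∀ F, ‖F‖ ≤ s F * ‖h‖ := fun F =>
    (ContinuousMap.norm_le _ (by positivity)).2 fun x => (hs_self F x).trans
      (mul_le_mul_of_nonneg_left ((le_abs_self _).trans (h.norm_coe_le_norm x)) (norm_nonneg _))
  refine squeeze_zero (fun _ => norm_nonneg _) (fun k => hbd _) ?_
  simpa using he.mul_const ‖h‖

/-! ### The invariant measure -/

/-- The Riesz–Markov–Kakutani theorem for functionals on `C(X, ℝ)` with `X` compact. -/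
theorem exists_measure_integral_eq {X : Type*} [TopologicalSpace X] [CompactSpace X] [T2Space X]
    [MeasurableSpace X] [BorelSpace X] (Λ : C(X, ℝ) →ₗ[ℝ] ℝ) (hΛ : ∀ f, 0 ≤ f → 0 ≤ Λ f)
    (h1 : Λ 1 = 1) :
    ∃ ν : Measure X, IsProbabilityMeasure ν ∧ ∀ f : C(X, ℝ), ∫ x, f x ∂ν = Λ f := by
  let Λc : CompactlySupportedContinuousMap X ℝ →ₚ[ℝ] ℝ := PositiveLinearMap.mk₀
    { toFun := fun f => Λ f.toContinuousMap
      map_add' := fun f g => Λ.map_add f.toContinuousMap g.toContinuousMap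
      map_smul' := fun c f => Λ.map_smul c f.toContinuousMap }
    fun f hf => hΛ _ hf
  have hint : ∀ f : C(X, ℝ), ∫ x, f x ∂(RealRMK.rieszMeasure Λc) = Λ f := fun f =>
    RealRMK.integral_rieszMeasure Λc (CompactlySupportedContinuousMap.continuousMapEquiv f)
  refine ⟨RealRMK.rieszMeasure Λc, ⟨?_⟩, hint⟩
  have h := hint 1
  simp only [ContinuousMap.one_apply, integral_const, smul_eq_mul, mul_one, h1] at h
  exact (ENNReal.toReal_eq_one_iff _).1 h

/-- Convergence of the powers of `T` to multiples of an eigenvector defines the invariant measure: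
it is the functional of the limiting multiples, after rescaling the eigenvector. -/
theorem IsPrimitiveOperator.exists_measure {X : Type*} [TopologicalSpace X] [CompactSpace X]
    [T2Space X] [Nonempty X] [MeasurableSpace X] [BorelSpace X] {T : C(X, ℝ) →L[ℝ] C(X, ℝ)}
    (hT : IsPrimitiveOperator T) {h : C(X, ℝ)} (hpos : ∀ x, 0 < h x) (hTh : T h = h)
    (hconv : ∀ f, ∃ c : ℝ, Tendsto (fun k : ℕ => (T ^ k) f) atTop (𝓝 (c • h))) :
    ∃ (h' : C(X, ℝ)) (ν : Measure X), (∀ x, 0 < h' x) ∧ T h' = h' ∧ IsProbabilityMeasure ν ∧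
      (∀ f : C(X, ℝ), ∫ x, T f x ∂ν = ∫ x, f x ∂ν) ∧
      ∀ f : C(X, ℝ), Tendsto (fun k : ℕ => (T ^ k) f) atTop (𝓝 ((∫ x, f x ∂ν) • h')) := by
  choose M hM using hconv
  obtain ⟨x₀⟩ := ‹Nonempty X›
  have hM_unique : ∀ (f : C(X, ℝ)) (c : ℝ),
      Tendsto (fun k : ℕ => (T ^ k) f) atTop (𝓝 (c • h)) → M f = c := fun f c hc => by
    have := congrArg (fun F : C(X, ℝ) => F x₀) (tendsto_nhds_unique (hM f) hc)
    exact mul_right_cancel₀ (hpos x₀).ne' this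
  have hM_mono : ∀ f g : C(X, ℝ), f ≤ g → M f ≤ M g := fun f g hfg =>
    le_of_mul_le_mul_right
      (le_of_tendsto_of_tendsto' (hM f) (hM g) (fun k => hT.pow_mono hfg k) x₀) (hpos x₀)
  have hM_smul : ∀ (c : ℝ) (f : C(X, ℝ)), M (c • f) = c * M f := fun c f => by
    refine hM_unique _ _ ?_
    simpa only [map_smul, mul_smul] using (hM f).const_smul c
  have hM_add : ∀ f g : C(X, ℝ), M (f + g) = M f + M g := fun f g => by
    refine hM_unique _ _ ?_
    simpa only [map_add, add_smul] using (hM f).add (hM g)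
  have hM_T : ∀ f, M (T f) = M f := fun f => by
    refine hM_unique _ _ (((tendsto_add_atTop_iff_nat 1).2 (hM f)).congr fun k => ?_)
    rw [pow_succ]
    rfl
  -- Comparing the constant function `1` with `h` shows that its limiting multiple is positive.
  have hM_h : M h = 1 := hM_unique _ _ <| by
    have : ∀ k : ℕ, (T ^ k) h = h := fun k => by
      simpa using pow_apply_eigen (l := 1) (by simpa using hTh) k
    simp [this]
  have hM1 : 0 < M 1 := by
    have h1 : h ≤ ‖h‖ • (1 : C(X, ℝ)) := fun x => by
      change h x ≤ ‖h‖ * 1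
      rw [mul_one]
      exact (le_abs_self _).trans (h.norm_coe_le_norm x)
    have h2 := hM_mono _ _ h1
    rw [hM_h, hM_smul] at h2
    exact pos_of_mul_pos_right (zero_lt_one.trans_le h2) (norm_nonneg h)
  let Λ : C(X, ℝ) →ₗ[ℝ] ℝ :=
    { toFun := fun f => (M 1)⁻¹ * M f
      map_add' := fun f g => by rw [hM_add, mul_add]
      map_smul' := fun c f => by
        rw [hM_smul]
        simp only [RingHom.id_apply, smul_eq_mul]
        ring }
  have hM0 : M 0 = 0 := by simpa using hM_smul 0 0
  obtain ⟨ν, hν, hint⟩ := exists_measure_integral_eq Λ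
    (fun f hf => mul_nonneg (inv_pos.2 hM1).le (hM0 ▸ hM_mono 0 f hf)) (inv_mul_cancel₀ hM1.ne')
  refine ⟨M 1 • h, ν, fun x => mul_pos hM1 (hpos x), by rw [map_smul, hTh], hν, fun f => ?_,
    fun f => ?_⟩
  · rw [hint, hint]
    change (M 1)⁻¹ * M (T f) = (M 1)⁻¹ * M f
    rw [hM_T]
  · rw [hint, smul_smul, show Λ f * M 1 = M f from ?_]
    · exact hM f
    · change (M 1)⁻¹ * M f * M 1 = M f
      field_simp

namespace MarkovSpace

variable {n : ℕ} {A : Matrix (Fin n) (Fin n) ℕ}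

/-! ### The transfer operator on real functions -/

/-- A real continuous function, viewed as a complex one. -/
noncomputable def complexify (f : C(MarkovSpace A, ℝ)) : C(MarkovSpace A, ℂ) :=
  ⟨fun x => (f x : ℂ), by fun_prop⟩

@[simp]
theorem complexify_apply (f : C(MarkovSpace A, ℝ)) (x : MarkovSpace A) :
    complexify f x = (f x : ℂ) := rfl

/-- The value of `L_φ f` for a real function `f`, as a sum over the symbols that can be prepended
to the point. -/
noncomputable def ruelleSum (φ f : C(MarkovSpace A, ℝ)) (x : MarkovSpace A) : ℝ :=
  ∑ j : Fin n, if h : A j (x.1 0) = 1 then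
    Real.exp (φ (prepend j x h)) * f (prepend j x h) else 0

theorem ruelle_complexify_apply (φ f : C(MarkovSpace A, ℝ)) (x : MarkovSpace A) :
    ruelle φ (complexify f) x = (ruelleSum φ f x : ℂ) := by
  change transferFun (fun y => ((Real.exp (φ y) : ℝ) : ℂ) * (f y : ℂ)) x = _
  rw [transferFun_eq, ruelleSum, Complex.ofReal_sum]
  refine Finset.sum_congr rfl fun j _ => ?_
  split_ifs <;> simp

/-- The transfer operator `L_φ` as a bounded operator on `C(Σ_A, ℝ)`. -/
noncomputable def realRuelle (φ : C(MarkovSpace A, ℝ)) :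
    C(MarkovSpace A, ℝ) →L[ℝ] C(MarkovSpace A, ℝ) :=
  LinearMap.mkContinuous
    { toFun := fun f => ⟨ruelleSum φ f, by
        have h : ruelleSum φ f = fun x => (ruelle φ (complexify f) x).re := by
          ext x
          rw [ruelle_complexify_apply, Complex.ofReal_re]
        rw [h]
        fun_prop⟩
      map_add' := fun f g => by
        ext x
        change ruelleSum φ (f + g) x = ruelleSum φ f x + ruelleSum φ g x
        simp only [ruelleSum, ← Finset.sum_add_distrib]
        refine Finset.sum_congr rfl fun j _ => ?_
        split_ifs <;> simp [mul_add]
      map_smul' := fun c f => by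
        ext x
        change ruelleSum φ (c • f) x = c * ruelleSum φ f x
        simp only [ruelleSum, Finset.mul_sum]
        refine Finset.sum_congr rfl fun j _ => ?_
        split_ifs <;> simp [mul_left_comm] }
    (n * Real.exp ‖φ‖) fun f => by
      refine (ContinuousMap.norm_le _ (by positivity)).2 fun x => ?_
      change ‖ruelleSum φ f x‖ ≤ _
      refine (norm_sum_le_of_le (f := fun j : Fin n => if h : A j (x.1 0) = 1 then
        Real.exp (φ (prepend j x h)) * f (prepend j x h) else 0)
        (n := fun _ => Real.exp ‖φ‖ * ‖f‖) _ fun j _ => ?_).trans_eq ?_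
      · split_ifs with h
        · rw [norm_mul, Real.norm_of_nonneg (Real.exp_pos _).le]
          gcongr
          · exact (le_abs_self _).trans (φ.norm_coe_le_norm _)
          · exact f.norm_coe_le_norm _
        · rw [norm_zero]
          positivity
      · simp [mul_assoc]

theorem realRuelle_apply (φ f : C(MarkovSpace A, ℝ)) (x : MarkovSpace A) :
    realRuelle φ f x = ∑ j : Fin n, if h : A j (x.1 0) = 1 then
      Real.exp (φ (prepend j x h)) * f (prepend j x h) else 0 := rfl

theorem ruelle_complexify (φ f : C(MarkovSpace A, ℝ)) :
    ruelle φ (complexify f) = complexify (realRuelle φ f) := by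
  ext x
  exact ruelle_complexify_apply φ f x

theorem ruelle_pow_complexify (φ f : C(MarkovSpace A, ℝ)) (k : ℕ) :
    (ruelle φ ^ k) (complexify f) = complexify ((realRuelle φ ^ k) f) := by
  induction k with
  | zero => rfl
  | succ k ih =>
    rw [pow_succ', pow_succ']
    change ruelle φ ((ruelle φ ^ k) (complexify f)) = _
    rw [ih, ruelle_complexify]
    rfl

theorem realRuelle_nonneg (φ : C(MarkovSpace A, ℝ)) {f : C(MarkovSpace A, ℝ)} (hf : 0 ≤ f) :
    0 ≤ realRuelle φ f := fun x => by
  change 0 ≤ realRuelle φ f x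
  rw [realRuelle_apply]
  refine Finset.sum_nonneg fun j _ => ?_
  split_ifs with h
  · exact mul_nonneg (Real.exp_pos _).le (hf _)
  · exact le_rfl

theorem exp_mul_le_realRuelle (φ : C(MarkovSpace A, ℝ)) {f : C(MarkovSpace A, ℝ)} (hf : 0 ≤ f)
    (y : MarkovSpace A) : Real.exp (φ y) * f y ≤ realRuelle φ f (shift y) := by
  obtain ⟨h, e⟩ := (shift_eq_iff (shift y) y).1 rfl
  have hle := Finset.single_le_sum (f := fun j : Fin n => if h : A j ((shift y).1 0) = 1 then
    Real.exp (φ (prepend j (shift y) h)) * f (prepend j (shift y) h) else 0)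
    (fun j _ => by
      split_ifs with h
      · exact mul_nonneg (Real.exp_pos _).le (hf _)
      · exact le_rfl) (Finset.mem_univ (y.1 0))
  rw [realRuelle_apply]
  simp only [dif_pos h, ← e] at hle
  exact hle

/-! ### Primitivity -/

theorem realRuelle_pow_pos_of_shift_eq (φ : C(MarkovSpace A, ℝ)) (k : ℕ) :
    ∀ {f : C(MarkovSpace A, ℝ)}, 0 ≤ f → ∀ w : MarkovSpace A, 0 < f w →
      0 < (realRuelle φ ^ k) f (shift^[k] w) := by
  induction k with
  | zero => exact fun _ w hw => hw
  | succ k ih =>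
    intro f hf w hw
    rw [pow_succ, Function.iterate_succ_apply]
    exact ih (realRuelle_nonneg φ hf) (shift w)
      ((mul_pos (Real.exp_pos _) hw).trans_le (exp_mul_le_realRuelle φ hf w))

/-- A positive entry of `A ^ k` yields an admissible word of length `k` from `i` to `x`. -/
theorem exists_shift_iterate_eq (hA01 : ∀ i j, A i j = 0 ∨ A i j = 1) (k : ℕ) :
    ∀ (i : Fin n) (x : MarkovSpace A), 0 < (A ^ k) i (x.1 0) →
      ∃ w : MarkovSpace A, w.1 0 = i ∧ shift^[k] w = x := by
  induction k with
  | zero =>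
    intro i x h
    refine ⟨x, ?_, rfl⟩
    by_contra hne
    simp [Ne.symm hne] at h
  | succ k ih =>
    intro i x h
    rw [pow_succ', Matrix.mul_apply] at h
    obtain ⟨l, -, hl⟩ := Finset.exists_ne_zero_of_sum_ne_zero h.ne'
    obtain ⟨h1, h2⟩ := mul_ne_zero_iff.1 hl
    obtain ⟨w, hw0, hw⟩ := ih l x (Nat.pos_of_ne_zero h2)
    refine ⟨prepend i w (hw0 ▸ (hA01 i l).resolve_left h1), rfl, ?_⟩
    rw [Function.iterate_succ_apply]
    exact hw

/-- The first `N` symbols of `x` can be followed by any `w` that starts with the symbol `x N`. -/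
theorem exists_agree_shift_iterate_eq (N : ℕ) :
    ∀ x w : MarkovSpace A, w.1 0 = x.1 N →
      ∃ z : MarkovSpace A, (∀ i, i ≤ N → z.1 i = x.1 i) ∧ shift^[N] z = w := by
  induction N with
  | zero => exact fun x w h => ⟨w, fun i hi => by rw [Nat.le_zero.1 hi, h], rfl⟩
  | succ N ih =>
    intro x w h
    obtain ⟨z, hz, hzw⟩ := ih (shift x) w h
    have hz0 : z.1 0 = x.1 1 := hz 0 (Nat.zero_le _)
    refine ⟨prepend (x.1 0) z (by rw [hz0]; exact x.2 0), fun i hi => ?_, ?_⟩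
    · cases i with
      | zero => rfl
      | succ i => exact hz i (Nat.le_of_succ_le_succ hi)
    · rw [Function.iterate_succ_apply]
      exact hzw

/-- If `x` and `y N` share longer and longer prefixes, then `y` converges to `x`. -/
theorem tendsto_of_agree {y : ℕ → MarkovSpace A} {x : MarkovSpace A}
    (h : ∀ i, ∀ᶠ N in atTop, (y N).1 i = x.1 i) : Tendsto y atTop (𝓝 x) := by
  rw [tendsto_subtype_rng, tendsto_pi_nhds]
  exact fun i => tendsto_const_nhds.congr' ((h i).mono fun N hN => hN.symm)

/-- A nonnegative `f` with `f x₀ > 0` is positive on a cylinder around `x₀`; this cylinder contains a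
preimage under a fixed power of the shift of every point, because `A ^ m` has positive entries. -/
theorem isPrimitiveOperator_realRuelle (hA01 : ∀ i j, A i j = 0 ∨ A i j = 1)
    (hA : ∃ m : ℕ, 0 < m ∧ ∀ i j, 0 < (A ^ m) i j) (φ : C(MarkovSpace A, ℝ)) :
    IsPrimitiveOperator (realRuelle φ) where
  nonneg _ := realRuelle_nonneg φ
  pos f hf hf0 := by
    obtain ⟨m, hm, hAm⟩ := hA
    obtain ⟨x₀, hx₀⟩ : ∃ x₀, f x₀ ≠ 0 := by
      by_contra! h
      exact hf0 (ContinuousMap.ext h)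
    have hfx₀ : 0 < f x₀ := lt_of_le_of_ne (hf x₀) (Ne.symm hx₀)
    obtain ⟨N, hN⟩ : ∃ N, ∀ z : MarkovSpace A, (∀ i, i ≤ N → z.1 i = x₀.1 i) → 0 < f z := by
      by_contra! h
      choose z hz hfz using h
      have hz' : Tendsto z atTop (𝓝 x₀) :=
        tendsto_of_agree fun i => (eventually_ge_atTop i).mono fun N hN => hz N i hN
      exact (le_of_tendsto' ((f.continuous.tendsto x₀).comp hz') hfz).not_gt hfx₀
    refine ⟨m + N, by omega, fun x => ?_⟩
    obtain ⟨w, hw0, hw⟩ := exists_shift_iterate_eq hA01 m (x₀.1 N) x (hAm _ _)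
    obtain ⟨z, hz, hzw⟩ := exists_agree_shift_iterate_eq N x₀ w hw0
    have := realRuelle_pow_pos_of_shift_eq φ (m + N) hf z (hN z hz)
    rwa [Function.iterate_add_apply, hzw, hw] at this

theorem nonempty (hn : 1 ≤ n) (hA01 : ∀ i j, A i j = 0 ∨ A i j = 1)
    (hA : ∃ m : ℕ, 0 < m ∧ ∀ i j, 0 < (A ^ m) i j) : Nonempty (MarkovSpace A) := by
  obtain ⟨m, hm, hAm⟩ := hA
  have hrow : ∀ i, ∃ j, A i j = 1 := fun i => by
    have h := hAm i i
    obtain ⟨k, rfl⟩ := Nat.exists_eq_add_of_lt hm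
    rw [zero_add, pow_succ', Matrix.mul_apply] at h
    obtain ⟨l, -, hl⟩ := Finset.exists_ne_zero_of_sum_ne_zero h.ne'
    exact ⟨l, (hA01 i l).resolve_left (mul_ne_zero_iff.1 hl).1⟩
  choose g hg using hrow
  refine ⟨⟨fun i => g^[i] ⟨0, hn⟩, fun i => ?_⟩⟩
  beta_reduce
  rw [Function.iterate_succ_apply']
  exact hg _

/-! ### Cones of functions with controlled logarithmic oscillation -/

/-- Nonnegative continuous functions whose values at two points that share their first `N ≥ 1`
symbols differ by a factor of at most `exp (ω N)`. The case `N = 0` is excluded, because points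
with different first symbols have different sets of preimage symbols. -/
def logCone (ω : ℕ → ℝ) : Set C(MarkovSpace A, ℝ) :=
  {f | 0 ≤ f ∧ ∀ N, 1 ≤ N → ∀ x y : MarkovSpace A, (∀ i, i < N → x.1 i = y.1 i) →
    f x ≤ Real.exp (ω N) * f y}

theorem smul_mem_logCone {ω : ℕ → ℝ} {f : C(MarkovSpace A, ℝ)} (hf : f ∈ logCone ω) {c : ℝ}
    (hc : 0 ≤ c) : c • f ∈ logCone ω :=
  ⟨smul_nonneg hc hf.1, fun N hN x y hxy => by
    simp only [ContinuousMap.smul_apply, smul_eq_mul]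
    rw [mul_left_comm]
    exact mul_le_mul_of_nonneg_left (hf.2 N hN x y hxy) hc⟩

/-- Prepending a symbol to two points lengthens their common prefix by one, so the oscillation of
`exp φ * f` at depth `N + 1` controls that of `L_φ f` at depth `N`. -/
theorem realRuelle_mem_logCone {φ : C(MarkovSpace A, ℝ)} {κ ω : ℕ → ℝ}
    (hφ : ∀ N, ∀ x y : MarkovSpace A, (∀ i, i < N → x.1 i = y.1 i) → |φ x - φ y| ≤ κ N)
    (hω : ∀ N, κ (N + 1) + ω (N + 1) ≤ ω N) {f : C(MarkovSpace A, ℝ)} (hf : f ∈ logCone ω) :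
    realRuelle φ f ∈ logCone ω := by
  refine ⟨realRuelle_nonneg φ hf.1, fun N hN x y hxy => ?_⟩
  rw [realRuelle_apply, realRuelle_apply, Finset.mul_sum]
  have h0 : x.1 0 = y.1 0 := hxy 0 hN
  refine Finset.sum_le_sum fun j _ => ?_
  by_cases hx : A j (x.1 0) = 1
  · have hy : A j (y.1 0) = 1 := h0 ▸ hx
    rw [dif_pos hx, dif_pos hy]
    have hagree : ∀ i, i < N + 1 → (prepend j x hx).1 i = (prepend j y hy).1 i := fun i hi => by
      cases i with
      | zero => rfl
      | succ i => exact hxy i (Nat.lt_of_succ_lt_succ hi)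
    have h1 := hf.2 (N + 1) (Nat.le_add_left _ _) _ _ hagree
    have h2 := le_of_abs_le (hφ (N + 1) _ _ hagree)
    have hfy : 0 ≤ f (prepend j y hy) := hf.1 _
    calc Real.exp (φ (prepend j x hx)) * f (prepend j x hx)
        ≤ Real.exp (κ (N + 1) + φ (prepend j y hy)) *
          (Real.exp (ω (N + 1)) * f (prepend j y hy)) := by
          refine mul_le_mul (Real.exp_le_exp.2 (by linarith)) h1 (hf.1 _) (Real.exp_pos _).le
      _ = Real.exp (κ (N + 1) + ω (N + 1)) *
          (Real.exp (φ (prepend j y hy)) * f (prepend j y hy)) := by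
          rw [Real.exp_add, Real.exp_add]
          ring
      _ ≤ _ := by
          gcongr
          exact hω N
  · have hy : ¬ A j (y.1 0) = 1 := h0 ▸ hx
    rw [dif_neg hx, dif_neg hy, mul_zero]

theorem isClosed_logCone (ω : ℕ → ℝ) : IsClosed (logCone (A := A) ω) := by
  have h : logCone (A := A) ω = Set.Ici 0 ∩ ⋂ (N) (_ : 1 ≤ N) (x : MarkovSpace A)
      (y : MarkovSpace A) (_ : ∀ i, i < N → x.1 i = y.1 i),
      {f : C(MarkovSpace A, ℝ) | f x ≤ Real.exp (ω N) * f y} := by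
    ext f
    simp [logCone]
  rw [h]
  exact isClosed_Ici.inter <| isClosed_iInter fun N => isClosed_iInter fun _ =>
    isClosed_iInter fun x => isClosed_iInter fun y => isClosed_iInter fun _ =>
    isClosed_le (continuous_eval_const x) (continuous_const.mul (continuous_eval_const y))

theorem eventually_agree (x : MarkovSpace A) (N : ℕ) :
    ∀ᶠ y in 𝓝 x, ∀ i, i < N → x.1 i = y.1 i := by
  refine (Filter.eventually_all_finite (Set.finite_Iio N)).2 fun i _ => ?_
  have hc : Continuous fun y : MarkovSpace A => y.1 i :=
    (continuous_apply i).comp continuous_subtype_val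
  exact (hc.tendsto x).eventually ((isOpen_discrete {b | x.1 i = b}).mem_nhds rfl)

/-- Bounded parts of a cone are compact by the Arzelà–Ascoli theorem. -/
theorem isCompact_logCone {ω : ℕ → ℝ} (hω : Tendsto ω atTop (𝓝 0)) (c : ℝ) :
    IsCompact (logCone (A := A) ω ∩ {f | ‖f‖ ≤ c}) := by
  set S := logCone (A := A) ω ∩ {f | ‖f‖ ≤ c}
  have hclosed : IsClosed S :=
    (isClosed_logCone ω).inter (isClosed_le continuous_norm continuous_const)
  let e := ContinuousMap.isometryEquivBoundedOfCompact (MarkovSpace A) ℝ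
  have hequi : ∀ x : MarkovSpace A, ∀ ε > 0, ∀ᶠ y in 𝓝 x, ∀ f ∈ S, dist (f x) (f y) < ε := by
    intro x ε hε
    have hlim : Tendsto (fun N => |Real.exp (ω N) - 1| * c) atTop (𝓝 0) := by
      have := (((Real.continuous_exp.tendsto 0).comp hω).sub_const 1).abs.mul_const c
      simpa using this
    obtain ⟨N, hN, hN1⟩ := ((hlim.eventually_lt_const hε).and (eventually_ge_atTop 1)).exists
    filter_upwards [eventually_agree x N] with y hxy f hf
    have hle : ∀ z w, (∀ i, i < N → z.1 i = w.1 i) → f z - f w < ε := fun z w hzw => by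
      have h1 := hf.1.2 N hN1 z w hzw
      have h2 : |f w| ≤ c := (f.norm_coe_le_norm w).trans hf.2
      have h3 : (Real.exp (ω N) - 1) * f w ≤ |Real.exp (ω N) - 1| * c :=
        (le_abs_self _).trans
          ((abs_mul _ _).trans_le (mul_le_mul_of_nonneg_left h2 (abs_nonneg _)))
      linarith
    rw [Real.dist_eq, abs_lt]
    constructor
    · linarith [hle y x fun i hi => (hxy i hi).symm]
    · exact hle x y hxy
  have hcompact : IsCompact (e '' S) := by
    refine BoundedContinuousFunction.arzela_ascoli₂ (Metric.closedBall 0 c)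
      (isCompact_closedBall 0 c) _ (e.toHomeomorph.isClosedMap _ hclosed) ?_ ?_
    · rintro _ x ⟨f, hf, rfl⟩
      rw [mem_closedBall_zero_iff]
      exact (f.norm_coe_le_norm x).trans hf.2
    · intro x
      rw [Metric.equicontinuousAt_iff_right]
      intro ε hε
      filter_upwards [hequi x ε hε] with y hy
      rintro ⟨_, f, hf, rfl⟩
      exact hy f hf
  exact e.toHomeomorph.isCompact_image.1 hcompact

/-! ### Moduli of continuity -/

theorem exists_agree_imp_abs_sub_le (F : C(MarkovSpace A, ℝ)) {ε : ℝ} (hε : 0 < ε) :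
    ∃ N, ∀ x y : MarkovSpace A, (∀ i, i < N → x.1 i = y.1 i) → |F x - F y| ≤ ε := by
  by_contra! h
  choose x y hxy hF using h
  have : FirstCountableTopology (MarkovSpace A) :=
    Topology.IsInducing.subtypeVal.firstCountableTopology
  obtain ⟨a, -, u, hu, hua⟩ := isCompact_univ.tendsto_subseq fun N => Set.mem_univ (x N)
  have hya : Tendsto (y ∘ u) atTop (𝓝 a) := tendsto_of_agree fun i => by
    have h1 := hua.eventually (eventually_agree a (i + 1))
    filter_upwards [h1, hu.tendsto_atTop.eventually_ge_atTop (i + 1)] with N hN hNi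
    exact ((hN i (Nat.lt_succ_self i)).trans (hxy (u N) i hNi)).symm
  have hlim := (((F.continuous.tendsto a).comp hua).sub ((F.continuous.tendsto a).comp hya)).abs
  rw [sub_self, abs_zero] at hlim
  exact (ge_of_tendsto' hlim fun N => (hF (u N)).le).not_gt hε

theorem exists_modulus (F : C(MarkovSpace A, ℝ)) :
    ∃ ω : ℕ → ℝ, Antitone ω ∧ Tendsto ω atTop (𝓝 0) ∧
      ∀ N, ∀ x y : MarkovSpace A, (∀ i, i < N → x.1 i = y.1 i) → |F x - F y| ≤ ω N := by
  -- The oscillation of `F` over pairs of points that share their first `N` symbols.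
  let P (N : ℕ) : Type := {p : MarkovSpace A × MarkovSpace A // ∀ i, i < N → p.1.1 i = p.2.1 i}
  let ω (N : ℕ) : ℝ := ⨆ p : P N, |F p.1.1 - F p.1.2|
  have hle : ∀ N, ∀ x y : MarkovSpace A, (∀ i, i < N → x.1 i = y.1 i) → |F x - F y| ≤ ω N := by
    intro N x y hxy
    refine le_ciSup (f := fun p : P N => |F p.1.1 - F p.1.2|) ⟨‖F‖ + ‖F‖, ?_⟩ ⟨(x, y), hxy⟩
    rintro _ ⟨p, rfl⟩
    exact (abs_sub _ _).trans (add_le_add (F.norm_coe_le_norm _) (F.norm_coe_le_norm _))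
  have h0 : ∀ N, 0 ≤ ω N := fun N => Real.iSup_nonneg fun p => abs_nonneg _
  have hanti : Antitone ω := fun M N hMN =>
    Real.iSup_le (fun p => hle M _ _ fun i hi => p.2 i (hi.trans_le hMN)) (h0 M)
  refine ⟨ω, hanti, ?_, hle⟩
  rw [Metric.tendsto_atTop]
  intro ε hε
  obtain ⟨N, hN⟩ := exists_agree_imp_abs_sub_le F (half_pos hε)
  refine ⟨N, fun M hM => ?_⟩
  rw [Real.dist_eq, sub_zero, abs_of_nonneg (h0 M)]
  have h1 : ω N ≤ ε / 2 := Real.iSup_le (fun p => hN _ _ p.2) (half_pos hε).le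
  linarith [hanti hM]

/-! ### The Ruelle–Perron–Frobenius theorem -/

theorem IsHolder.exists_geometric_modulus {θ : ℝ} (hθ0 : 0 < θ) (hθ1 : θ < 1)
    {φ : MarkovSpace A → ℝ} (hφ : IsHolder θ φ) :
    ∃ K ρ : ℝ, 0 < K ∧ 0 < ρ ∧ ρ < 1 ∧ ∀ N, ∀ x y : MarkovSpace A,
      (∀ i, i < N → x.1 i = y.1 i) → |φ x - φ y| ≤ K * ρ ^ N := by
  obtain ⟨K, α, hK, hα, h⟩ := hφ
  refine ⟨K, θ ^ α, hK, Real.rpow_pos_of_pos hθ0 α, Real.rpow_lt_one hθ0.le hθ1 hα,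
    fun N x y hxy => ?_⟩
  rcases eq_or_ne x y with rfl | hne
  · rw [sub_self, abs_zero]
    positivity
  · refine (h x y).trans (mul_le_mul_of_nonneg_left ?_ hK.le)
    have hN : N ≤ PiNat.firstDiff (E := fun _ => Fin n) x.1 y.1 :=
      (PiNat.mem_cylinder_iff_le_firstDiff (fun e => hne (Subtype.ext e)) N).1 hxy
    rw [markovDist, if_neg hne, ← Real.rpow_natCast, ← Real.rpow_natCast, ← Real.rpow_mul hθ0.le,
      ← Real.rpow_mul hθ0.le, mul_comm α]
    refine Real.rpow_le_rpow_of_exponent_ge hθ0 hθ1.le ?_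
    gcongr

/-- The Ruelle–Perron–Frobenius theorem on real functions, apart from the identification of the
limiting multiples with integrals. -/
theorem exists_eigenvector_forall_tendsto [Nonempty (MarkovSpace A)]
    {φ : C(MarkovSpace A, ℝ)} (hL : IsPrimitiveOperator (realRuelle φ)) {K ρ : ℝ} (hK : 0 < K)
    (hρ0 : 0 < ρ) (hρ1 : ρ < 1) (hφ : ∀ N, ∀ x y : MarkovSpace A,
      (∀ i, i < N → x.1 i = y.1 i) → |φ x - φ y| ≤ K * ρ ^ N) :
    ∃ (l : ℝ) (h : C(MarkovSpace A, ℝ)), 0 < l ∧ (∀ x, 0 < h x) ∧ realRuelle φ h = l • h ∧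
      ∀ f, ∃ c : ℝ, Tendsto (fun k : ℕ => ((l⁻¹ • realRuelle φ) ^ k) f) atTop (𝓝 (c • h)) := by
  -- `B` is the fixed point of `B ↦ ρ * (K + B)`.
  set B : ℝ := K * ρ / (1 - ρ) with hB
  have hB0 : 0 < B := div_pos (mul_pos hK hρ0) (sub_pos.2 hρ1)
  have hBfix : K * ρ + B * ρ = B := by
    have : 1 - ρ ≠ 0 := (sub_pos.2 hρ1).ne'
    rw [hB]
    field_simp
    ring
  have hBstep : ∀ N : ℕ, K * ρ ^ (N + 1) + B * ρ ^ (N + 1) = B * ρ ^ N := fun N => by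
    rw [pow_succ, ← congrArg (· * ρ ^ N) hBfix]
    ring
  have hBlim : Tendsto (fun N : ℕ => B * ρ ^ N) atTop (𝓝 0) := by
    simpa using (tendsto_pow_atTop_nhds_zero_of_lt_one hρ0.le hρ1).const_mul B
  obtain ⟨l, h, hl, -, hpos, hLh⟩ := hL.exists_eigenvector (logCone fun N => B * ρ ^ N)
    (fun f hf => hf.1) (fun f hf => realRuelle_mem_logCone hφ (fun N => (hBstep N).le) hf)
    (fun f hf c hc => smul_mem_logCone hf hc.le)
    ((isCompact_logCone hBlim 1).of_isClosed_subset
      ((isClosed_logCone _).inter (isClosed_eq continuous_norm continuous_const))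
      fun f hf => ⟨hf.1, le_of_eq hf.2⟩)
    ⟨1, ⟨fun _ => zero_le_one, fun N _ x y _ => by
      simp only [ContinuousMap.one_apply, mul_one]
      exact Real.one_le_exp (by positivity)⟩, one_ne_zero⟩
  refine ⟨l, h, hl, hpos, hLh, ?_⟩
  have hT := hL.smul (inv_pos.2 hl)
  set T := l⁻¹ • realRuelle φ
  have hTh : T h = h := by
    change l⁻¹ • realRuelle φ h = h
    rw [hLh, inv_smul_smul₀ hl.ne']
  have hTkh : ∀ k : ℕ, (T ^ k) h = h := fun k => by
    simpa using pow_apply_eigen (l := 1) (by simpa using hTh) k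
  obtain ⟨d, hd, hdh⟩ := exists_pos_le_of_forall_pos h hpos
  -- The logarithm of a positive function has a modulus of continuity, so it lies in a cone.
  have hconv_pos : ∀ F : C(MarkovSpace A, ℝ), (∀ x, 0 < F x) →
      ∃ c : ℝ, Tendsto (fun k : ℕ => (T ^ k) F) atTop (𝓝 (c • h)) := by
    intro F hF
    obtain ⟨ω, hω_anti, hω_lim, hω⟩ :=
      exists_modulus ⟨fun x => Real.log (F x), F.continuous.log fun x => (hF x).ne'⟩
    have hF0 : 0 ≤ F := fun x => (hF x).le
    have hFmem : F ∈ logCone fun N => B * ρ ^ N + ω N := by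
      refine ⟨hF0, fun N _ x y hxy => ?_⟩
      have h1 : Real.log (F x) - Real.log (F y) ≤ ω N := le_of_abs_le (hω N x y hxy)
      have h2 : 0 ≤ B * ρ ^ N := by positivity
      rw [← Real.log_le_log_iff (hF x) (mul_pos (Real.exp_pos _) (hF y)),
        Real.log_mul (Real.exp_pos _).ne' (hF y).ne', Real.log_exp]
      linarith
    have hmem : ∀ k : ℕ, (T ^ k) F ∈ logCone fun N => B * ρ ^ N + ω N := fun k => by
      induction k with
      | zero => exact hFmem
      | succ k ih =>
        rw [pow_succ']
        refine smul_mem_logCone (realRuelle_mem_logCone hφ (fun N => ?_) ih) (inv_pos.2 hl).le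
        have := hω_anti (Nat.le_succ N)
        linarith [hBstep N]
    have hFh : F ≤ (‖F‖ / d) • h := fun x => by
      change F x ≤ ‖F‖ / d * h x
      rw [div_mul_eq_mul_div, le_div_iff₀ hd]
      exact mul_le_mul ((le_abs_self _).trans (F.norm_coe_le_norm x)) (hdh x) hd.le (norm_nonneg F)
    refine hT.exists_tendsto hpos hTh hF0
      (isCompact_logCone (by simpa using hBlim.add hω_lim) (‖F‖ / d * ‖h‖))
      fun k => ⟨hmem k, (ContinuousMap.norm_le _ (by positivity)).2 fun x => ?_⟩
    have h1 := hT.pow_mono hFh k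
    rw [map_smul, hTkh] at h1
    rw [Real.norm_of_nonneg (show 0 ≤ ((T ^ k) F) x from hT.pow_nonneg hF0 k x)]
    exact (h1 x).trans (mul_le_mul_of_nonneg_left
      ((le_abs_self _).trans (h.norm_coe_le_norm x)) (by positivity))
  intro f
  obtain ⟨a, ha⟩ := hconv_pos (f + (‖f‖ + 1) • 1) fun x => by
    change 0 < f x + (‖f‖ + 1) * 1
    have := neg_le_of_abs_le (f.norm_coe_le_norm x)
    linarith
  obtain ⟨b, hb⟩ := hconv_pos 1 fun _ => zero_lt_one
  refine ⟨a - (‖f‖ + 1) * b, ?_⟩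
  rw [sub_smul, mul_smul]
  refine (ha.sub (hb.const_smul (‖f‖ + 1))).congr fun k => ?_
  rw [map_add, map_smul, add_sub_cancel_right]

theorem exists_eq_complexify_add (g : C(MarkovSpace A, ℂ)) :
    ∃ u v : C(MarkovSpace A, ℝ), g = complexify u + Complex.I • complexify v := by
  refine ⟨⟨fun x => (g x).re, by fun_prop⟩, ⟨fun x => (g x).im, by fun_prop⟩, ?_⟩
  ext x
  simp [mul_comm Complex.I, Complex.re_add_im]

theorem norm_complexify (f : C(MarkovSpace A, ℝ)) : ‖complexify f‖ = ‖f‖ := by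
  apply le_antisymm
  · exact (ContinuousMap.norm_le _ (norm_nonneg _)).2 fun x => by
      simpa using f.norm_coe_le_norm x
  · exact (ContinuousMap.norm_le _ (norm_nonneg _)).2 fun x => by
      simpa using (complexify f).norm_coe_le_norm x

theorem complexify_sub_smul (f h : C(MarkovSpace A, ℝ)) (a b : ℝ) :
    complexify (a • f - b • h) = (a : ℂ) • complexify f - (b : ℂ) • complexify h := by
  ext x
  simp

theorem integral_complexify_add (ν : Measure (MarkovSpace A)) [IsProbabilityMeasure ν]
    (u v : C(MarkovSpace A, ℝ)) :
    ∫ x, (complexify u + Complex.I • complexify v) x ∂ν =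
      ((∫ x, u x ∂ν : ℝ) : ℂ) + Complex.I * ((∫ x, v x ∂ν : ℝ) : ℂ) := by
  have hint : ∀ f : C(MarkovSpace A, ℂ), Integrable (fun x => f x) ν := fun f =>
    f.continuous.integrable_of_hasCompactSupport (HasCompactSupport.of_compactSpace _)
  have h := integral_add (hint (complexify u)) (hint (Complex.I • complexify v))
  simp only [ContinuousMap.smul_apply, complexify_apply, smul_eq_mul, integral_const_mul,
    integral_complex_ofReal] at h
  simpa using h

theorem exists_isRuelleEigenvalue [Nonempty (MarkovSpace A)] {φ : C(MarkovSpace A, ℝ)}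
    (hL : IsPrimitiveOperator (realRuelle φ)) {θ : ℝ} (hθ0 : 0 < θ) (hθ1 : θ < 1)
    (hφ : IsHolder θ φ) : ∃ l, IsRuelleEigenvalue φ l := by
  obtain ⟨K, ρ, hK, hρ0, hρ1, hmod⟩ := hφ.exists_geometric_modulus hθ0 hθ1
  obtain ⟨l, h₀, hl, hpos₀, hLh₀, hconv₀⟩ :=
    exists_eigenvector_forall_tendsto hL hK hρ0 hρ1 hmod
  have hTh₀ : (l⁻¹ • realRuelle φ) h₀ = h₀ := by
    change l⁻¹ • realRuelle φ h₀ = h₀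
    rw [hLh₀, inv_smul_smul₀ hl.ne']
  obtain ⟨h, ν, hpos, hTh, hν, hinv, hconv⟩ :=
    (hL.smul (inv_pos.2 hl)).exists_measure hpos₀ hTh₀ hconv₀
  refine ⟨l, hl, complexify h, ν, fun x => ⟨by simpa using hpos x, by simp⟩, hν, ?_, fun f => ?_,
    fun g => ?_⟩
  · have hLh : realRuelle φ h = l • h := by
      rw [← inv_smul_eq_iff₀ hl.ne']
      exact hTh
    rw [ruelle_complexify, hLh]
    ext x
    simp
  · obtain ⟨u, v, rfl⟩ := exists_eq_complexify_add f
    have hreal : ∀ w : C(MarkovSpace A, ℝ), ∫ x, realRuelle φ w x ∂ν = l * ∫ x, w x ∂ν :=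
      fun w => by
        have h1 : ∫ x, l⁻¹ * realRuelle φ w x ∂ν = ∫ x, w x ∂ν := hinv w
        rw [integral_const_mul] at h1
        rw [← h1, mul_inv_cancel_left₀ hl.ne']
    rw [map_add, map_smul, ruelle_complexify, ruelle_complexify, integral_complexify_add,
      integral_complexify_add, hreal, hreal]
    push_cast
    ring
  · obtain ⟨u, v, rfl⟩ := exists_eq_complexify_add g
    have hnorm : ∀ w : C(MarkovSpace A, ℝ), Tendsto (fun k : ℕ =>
        ‖(l ^ k)⁻¹ • (realRuelle φ ^ k) w - (∫ x, w x ∂ν) • h‖) atTop (𝓝 0) := fun w => by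
      refine (tendsto_iff_norm_sub_tendsto_zero.1 (hconv w)).congr fun k => ?_
      rw [smul_pow_apply, inv_pow]
    refine squeeze_zero (fun _ => norm_nonneg _) (fun k => ?_)
      (by simpa only [add_zero] using (hnorm u).add (hnorm v))
    have hsplit : ((l : ℂ) ^ k)⁻¹ • (ruelle φ ^ k) (complexify u + Complex.I • complexify v) -
        (∫ x, (complexify u + Complex.I • complexify v) x ∂ν) • complexify h =
        complexify ((l ^ k)⁻¹ • (realRuelle φ ^ k) u - (∫ x, u x ∂ν) • h) +
        Complex.I • complexify ((l ^ k)⁻¹ • (realRuelle φ ^ k) v - (∫ x, v x ∂ν) • h) := by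
      rw [integral_complexify_add, map_add, map_smul, ruelle_pow_complexify,
        ruelle_pow_complexify, complexify_sub_smul, complexify_sub_smul]
      push_cast
      module
    rw [hsplit]
    refine (norm_add_le _ _).trans_eq ?_
    rw [norm_smul, Complex.norm_I, one_mul, norm_complexify, norm_complexify]

/-! ### Comparison of Ruelle eigenvalues -/

theorem IsRuelleEigenvalue.exists_real {φ : C(MarkovSpace A, ℝ)} {l : ℝ}
    (hl : IsRuelleEigenvalue φ l) :
    ∃ (h : C(MarkovSpace A, ℝ)) (ν : Measure (MarkovSpace A)), (∀ x, 0 < h x) ∧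
      IsProbabilityMeasure ν ∧ realRuelle φ h = l • h ∧
      ∀ f : C(MarkovSpace A, ℝ), ∫ x, realRuelle φ f x ∂ν = l * ∫ x, f x ∂ν := by
  obtain ⟨-, h, ν, hpos, hν, hLh, hint, -⟩ := hl
  let u : C(MarkovSpace A, ℝ) := ⟨fun x => (h x).re, by fun_prop⟩
  have hu : h = complexify u := by
    ext x
    exact Complex.ext rfl (hpos x).2
  refine ⟨u, ν, fun x => (hpos x).1, hν, ?_, fun f => ?_⟩
  · rw [hu, ruelle_complexify] at hLh
    ext x
    have := congrArg (fun F : C(MarkovSpace A, ℂ) => (F x).re) hLh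
    simpa using this
  · have := hint (complexify f)
    rw [ruelle_complexify] at this
    simp only [complexify_apply, integral_complex_ofReal] at this
    exact_mod_cast this

theorem exp_smul_realRuelle_le {φ ψ : C(MarkovSpace A, ℝ)} {c : ℝ} (hc : ∀ x, φ x + c ≤ ψ x)
    {f : C(MarkovSpace A, ℝ)} (hf : 0 ≤ f) (x : MarkovSpace A) :
    Real.exp c * realRuelle φ f x ≤ realRuelle ψ f x := by
  rw [realRuelle_apply, realRuelle_apply, Finset.mul_sum]
  refine Finset.sum_le_sum fun j _ => ?_
  split_ifs with h
  · rw [← mul_assoc, ← Real.exp_add]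
    refine mul_le_mul_of_nonneg_right (Real.exp_le_exp.2 ?_) (hf _)
    linarith [hc (prepend j x h)]
  · rw [mul_zero]

/-- Integrate `L_ψ h ≥ exp c • L_φ h` for the eigenfunction `h` of `φ` against the eigenmeasure
of `ψ`. -/
theorem IsRuelleEigenvalue.exp_mul_le {φ ψ : C(MarkovSpace A, ℝ)} {l l' c : ℝ}
    (hl : IsRuelleEigenvalue φ l) (hl' : IsRuelleEigenvalue ψ l') (hc : ∀ x, φ x + c ≤ ψ x) :
    Real.exp c * l ≤ l' := by
  obtain ⟨h, -, hpos, -, hLh, -⟩ := hl.exists_real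
  obtain ⟨-, ν, -, hν, -, hint⟩ := hl'.exists_real
  have hintegrable : ∀ f : C(MarkovSpace A, ℝ), Integrable (fun x => f x) ν := fun f =>
    f.continuous.integrable_of_hasCompactSupport (HasCompactSupport.of_compactSpace _)
  have : Nonempty (MarkovSpace A) := ν.nonempty_of_neZero
  obtain ⟨d, hd, hdh⟩ := exists_pos_le_of_forall_pos h hpos
  have hh : 0 < ∫ x, h x ∂ν := by
    have := integral_mono (integrable_const d) (hintegrable h) hdh
    simp only [integral_const, probReal_univ, one_smul] at this
    exact hd.trans_le this
  have h1 : ∫ x, Real.exp c * l * h x ∂ν ≤ ∫ x, realRuelle ψ h x ∂ν := by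
    refine integral_mono ((hintegrable h).const_mul _) (hintegrable _) fun x => ?_
    have := exp_smul_realRuelle_le hc (fun y => (hpos y).le : (0 : C(MarkovSpace A, ℝ)) ≤ h) x
    rw [hLh] at this
    simpa [mul_assoc] using this
  rw [integral_const_mul, hint] at h1
  exact le_of_mul_le_mul_right h1 hh

theorem IsRuelleEigenvalue.unique {φ : C(MarkovSpace A, ℝ)} {l l' : ℝ}
    (hl : IsRuelleEigenvalue φ l) (hl' : IsRuelleEigenvalue φ l') : l = l' :=
  le_antisymm (by simpa using hl.exp_mul_le hl' (c := 0) (by simp))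
    (by simpa using hl'.exp_mul_le hl (c := 0) (by simp))

theorem realRuelle_zero_pow_one (hA01 : ∀ i j, A i j = 0 ∨ A i j = 1) (k : ℕ) :
    ∀ x : MarkovSpace A, (realRuelle 0 ^ k) (1 : C(MarkovSpace A, ℝ)) x =
      ((∑ i, (A ^ k) i (x.1 0) : ℕ) : ℝ) := by
  induction k with
  | zero =>
    intro x
    simp [Matrix.one_apply]
  | succ k ih =>
    intro x
    have h1 : (realRuelle 0 ^ (k + 1)) (1 : C(MarkovSpace A, ℝ)) =
        realRuelle 0 ((realRuelle 0 ^ k) 1) := by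
      rw [pow_succ']
      rfl
    have h2 : ∑ i, (A ^ (k + 1)) i (x.1 0) = ∑ j, A j (x.1 0) * ∑ i, (A ^ k) i j := by
      simp only [pow_succ, Matrix.mul_apply, Finset.mul_sum]
      rw [Finset.sum_comm]
      exact Finset.sum_congr rfl fun j _ => Finset.sum_congr rfl fun i _ => mul_comm _ _
    rw [h1, h2, realRuelle_apply, Nat.cast_sum]
    refine Finset.sum_congr rfl fun j _ => ?_
    rcases hA01 j (x.1 0) with h | h
    · rw [dif_neg (by rw [h]; exact zero_ne_one), h]
      simp
    · rw [dif_pos h, ih, h]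
      simp [prepend]

/-- The value of `L_0 ^ m 1` at `x` is a column sum of `A ^ m`, hence at least `n`. Evaluate
`L_0 ^ m h = l ^ m • h` at a minimum of the eigenfunction `h`. -/
theorem IsRuelleEigenvalue.one_lt (hn : 2 ≤ n) (hA01 : ∀ i j, A i j = 0 ∨ A i j = 1)
    (hA : ∃ m : ℕ, 0 < m ∧ ∀ i j, 0 < (A ^ m) i j) {l : ℝ}
    (hl : IsRuelleEigenvalue (0 : C(MarkovSpace A, ℝ)) l) : 1 < l := by
  have hL := isPrimitiveOperator_realRuelle hA01 hA 0
  have := nonempty (one_le_two.trans hn) hA01 hA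
  obtain ⟨m, hm, hAm⟩ := hA
  obtain ⟨h, -, hpos, -, hLh, -⟩ := hl.exists_real
  obtain ⟨x, -, hx⟩ := isCompact_univ.exists_isMinOn Set.univ_nonempty h.continuous.continuousOn
  have hmin : h x • (1 : C(MarkovSpace A, ℝ)) ≤ h := fun y => by
    change h x * 1 ≤ h y
    rw [mul_one]
    exact hx (Set.mem_univ y)
  have h1 := hL.pow_mono hmin m x
  rw [map_smul, pow_apply_eigen hLh] at h1
  have h2 : h x * (realRuelle 0 ^ m) (1 : C(MarkovSpace A, ℝ)) x ≤ l ^ m * h x := h1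
  have h3 : (2 : ℝ) ≤ (realRuelle 0 ^ m) (1 : C(MarkovSpace A, ℝ)) x := by
    rw [realRuelle_zero_pow_one hA01]
    have hsum : n ≤ ∑ i, (A ^ m) i (x.1 0) := by
      simpa using Finset.sum_le_sum fun i (_ : i ∈ Finset.univ) => Nat.succ_le_of_lt (hAm i (x.1 0))
    exact_mod_cast hn.trans hsum
  rw [mul_comm] at h2
  have h4 : (1 : ℝ) < l ^ m := by
    have := le_of_mul_le_mul_right h2 (hpos x)
    linarith
  exact (one_lt_pow_iff_of_nonneg hl.1.le hm.ne').1 h4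

theorem isHolder_potential {θ : ℝ} {H : C(MarkovSpace A, ℝ)} (hHolder : IsHolder θ H)
    (hH : ∀ y, 1 < H y) {β : ℝ} (hβ : 0 ≤ β) :
    IsHolder θ (potential H (fun y => one_pos.trans (hH y)) β) := by
  obtain ⟨K, α, hK, hα, h⟩ := hHolder
  have hlog : ∀ x y, Real.log (H x) - Real.log (H y) ≤ |H x - H y| := fun x y => by
    have hx := one_pos.trans (hH x)
    have hy := one_pos.trans (hH y)
    rw [← Real.log_div hx.ne' hy.ne']
    refine (Real.log_le_sub_one_of_pos (div_pos hx hy)).trans ?_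
    rw [div_sub_one hy.ne', div_le_iff₀ hy]
    exact (le_abs_self _).trans (le_mul_of_one_le_right (abs_nonneg _) (hH y).le)
  refine ⟨(β + 1) * K, α, by positivity, hα, fun x y => ?_⟩
  have h1 : |Real.log (H x) - Real.log (H y)| ≤ |H x - H y| :=
    abs_le.2 ⟨by have := hlog y x; rw [abs_sub_comm] at this; linarith, hlog x y⟩
  change |-β * Real.log (H x) - -β * Real.log (H y)| ≤ _
  rw [← mul_sub, abs_mul, abs_neg, abs_of_nonneg hβ, mul_assoc]
  exact mul_le_mul (by linarith) (h1.trans (h x y)) (abs_nonneg _) (by linarith)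

end MarkovSpace

/-! ### The family `-β log H` -/

theorem proposition2p6 {n : ℕ} (hn : 1 ≤ n) (A : Matrix (Fin n) (Fin n) ℕ)
    (hA01 : ∀ i j, A i j = 0 ∨ A i j = 1)
    (hA : ∃ m : ℕ, 0 < m ∧ ∀ i j, 0 < (A ^ m) i j)
    (θ : ℝ) (hθ0 : 0 < θ) (hθ1 : θ < 1)
    (H : C(MarkovSpace A, ℝ)) (hHolder : MarkovSpace.IsHolder θ H)
    (hH : ∀ y, 1 < H y) :
    (∀ β : ℝ, 0 ≤ β → ∃! l : ℝ, MarkovSpace.IsRuelleEigenvalue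
      (MarkovSpace.potential H (fun y => one_pos.trans (hH y)) β) l) ∧
    ∀ lam : ℝ → ℝ,
      (∀ β : ℝ, 0 ≤ β → MarkovSpace.IsRuelleEigenvalue
        (MarkovSpace.potential H (fun y => one_pos.trans (hH y)) β) (lam β)) →
      (2 ≤ n → 1 < lam 0) ∧
      Filter.Tendsto lam Filter.atTop (𝓝 0) ∧
      StrictAntiOn lam (Set.Ici 0) ∧
      ContinuousOn lam (Set.Ici 0) := by
  have := MarkovSpace.nonempty hn hA01 hA
  refine ⟨fun β hβ => ?_, fun lam hlam => ?_⟩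
  · obtain ⟨l, hl⟩ := MarkovSpace.exists_isRuelleEigenvalue
      (MarkovSpace.isPrimitiveOperator_realRuelle hA01 hA _) hθ0 hθ1
      (MarkovSpace.isHolder_potential hHolder hH hβ)
    exact ⟨l, hl, fun l' hl' => hl'.unique hl⟩
  let logH : C(MarkovSpace A, ℝ) :=
    ⟨fun x => Real.log (H x), H.continuous.log fun x => (one_pos.trans (hH x)).ne'⟩
  obtain ⟨c, hc, hcH⟩ := exists_pos_le_of_forall_pos logH fun x => Real.log_pos (hH x)
  have hCH : ∀ x, logH x ≤ ‖logH‖ := fun x =>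
    (le_abs_self _).trans (logH.norm_coe_le_norm x)
  -- The potential decreases in `β` at a rate between `c` and `‖log H‖`.
  have hupper : ∀ β γ, 0 ≤ β → β ≤ γ → Real.exp ((γ - β) * c) * lam γ ≤ lam β :=
    fun β γ hβ hβγ => (hlam γ (hβ.trans hβγ)).exp_mul_le (hlam β hβ) fun x => by
      change -γ * logH x + (γ - β) * c ≤ -β * logH x
      nlinarith [mul_le_mul_of_nonneg_left (hcH x) (sub_nonneg.2 hβγ)]
  have hlower : ∀ β γ, 0 ≤ β → β ≤ γ → Real.exp (-((γ - β) * ‖logH‖)) * lam β ≤ lam γ :=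
    fun β γ hβ hβγ => (hlam β hβ).exp_mul_le (hlam γ (hβ.trans hβγ)) fun x => by
      change -β * logH x + -((γ - β) * ‖logH‖) ≤ -γ * logH x
      nlinarith [mul_le_mul_of_nonneg_left (hCH x) (sub_nonneg.2 hβγ)]
  have hpos : ∀ β, 0 ≤ β → 0 < lam β := fun β hβ => (hlam β hβ).1
  have hanti : StrictAntiOn lam (Set.Ici 0) := fun β hβ γ hγ hβγ => by
    refine lt_of_lt_of_le ?_ (hupper β γ hβ hβγ.le)
    exact lt_mul_of_one_lt_left (hpos γ hγ)
      (Real.one_lt_exp_iff.2 (mul_pos (sub_pos.2 hβγ) hc))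
  refine ⟨fun hn2 => ?_, ?_, hanti, fun β hβ => ?_⟩
  · have h0 : MarkovSpace.potential H (fun y => one_pos.trans (hH y)) 0 = 0 := by
      ext x
      simp [MarkovSpace.potential]
    exact (h0 ▸ hlam 0 le_rfl).one_lt hn2 hA01 hA
  · have hlim : Tendsto (fun β : ℝ => Real.exp (-(β * c)) * lam 0) atTop (𝓝 0) := by
      have := (Real.tendsto_exp_neg_atTop_nhds_zero.comp
        (tendsto_id.atTop_mul_const hc)).mul_const (lam 0)
      simpa using this
    refine squeeze_zero' ((eventually_ge_atTop 0).mono fun β hβ => (hpos β hβ).le)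
      ((eventually_ge_atTop 0).mono fun β hβ => ?_) hlim
    have h1 := hupper 0 β le_rfl hβ
    rw [sub_zero] at h1
    rwa [Real.exp_neg, ← div_eq_inv_mul, le_div_iff₀' (Real.exp_pos _)]
  · -- By monotonicity `lam γ` lies between `exp (∓ |γ - β| * ‖log H‖) * lam β`.
    have hlow : Tendsto (fun γ : ℝ => Real.exp (-(|γ - β| * ‖logH‖)) * lam β)
        (𝓝[Set.Ici 0] β) (𝓝 (lam β)) := by
      have h1 : Continuous fun γ : ℝ => Real.exp (-(|γ - β| * ‖logH‖)) * lam β := by fun_prop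
      simpa using (h1.tendsto β).mono_left nhdsWithin_le_nhds
    have hup : Tendsto (fun γ : ℝ => Real.exp (|γ - β| * ‖logH‖) * lam β)
        (𝓝[Set.Ici 0] β) (𝓝 (lam β)) := by
      have h1 : Continuous fun γ : ℝ => Real.exp (|γ - β| * ‖logH‖) * lam β := by fun_prop
      simpa using (h1.tendsto β).mono_left nhdsWithin_le_nhds
    have hexp : ∀ γ : ℝ, 0 ≤ |γ - β| * ‖logH‖ := fun γ =>
      mul_nonneg (abs_nonneg _) (norm_nonneg _)
    refine tendsto_of_tendsto_of_tendsto_of_le_of_le' hlow hup ?_ ?_ <;>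
      filter_upwards [self_mem_nhdsWithin] with γ hγ <;> rcases le_total β γ with h | h
    · rw [abs_of_nonneg (sub_nonneg.2 h)]
      exact hlower β γ hβ h
    · exact (mul_le_of_le_one_left (hpos β hβ).le
        (Real.exp_le_one_iff.2 (neg_nonpos.2 (hexp γ)))).trans (hanti.antitoneOn hγ hβ h)
    · exact (hanti.antitoneOn hβ hγ h).trans
        (le_mul_of_one_le_left (hpos β hβ).le (Real.one_le_exp (hexp γ)))
    · have h1 := hlower γ β hγ h
      rw [abs_sub_comm, abs_of_nonneg (sub_nonneg.2 h)]
      rwa [Real.exp_neg, inv_mul_le_iff₀ (Real.exp_pos _)] at h1
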